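/- Let $M,N,K$ be non-negative integers. Let $\beta_0,\delta_0\ge 0$ and, for $k=1,\dots,K$, let $\beta_k,\delta_k\ge0$, $\sigma_k>0$, $r_k>0$, $\rho_k\in(0,1]$; let $\sigma_z>0$. Let $\bar{\mathbf H}\in\mathbb C^{M\times N}$, $\bar{\mathbf h}_{\mathrm r,k}\in\mathbb C^{M}$, $\mathbf h_k\in\mathbb C^{N}$, $\mathbf G_k\in\mathbb C^{M\times N}$, and let $\boldsymbol\Sigma_{\mathrm B}\in\mathbb C^{N\times N}$, $\boldsymbol\Sigma_{\mathrm R},\boldsymbol\Sigma_{\mathrm r,k}\in\mathbb C^{M\times M}$ be (Hermitian) positive semidefinite with unit diagonal entries. Fix $\mathbf w\in\mathbb C^M$ and put $\boldsymbol\Lambda=\mathrm{Diag}(|w_1|^2,\dots,|w_M|^2)$, $\mathbf p=\mathrm{diag}(\boldsymbol\Lambda)$, $\tilde{\mathbf w}=\begin{bmatrix}\mathbf w\\1\end{bmatrix}$, $\mathbf H_k=\begin{bmatrix}\mathbf G_k\\ \mathbf h_k^{\mathrm H}\end{bmatrix}$, \[ \mathbf U_k=\tfrac{\beta_k}{\delta_k+1}\boldsymbol\Sigma_{\mathrm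 r,k}^{1/2}\boldsymbol\Lambda\boldsymbol\Sigma_{\mathrm r,k}^{1/2},\qquad \mathbf C_k=\bigl(\boldsymbol\Sigma_{\mathrm r,k}^{\mathrm T}+2\delta_k\bar{\mathbf h}_{\mathrm r,k}^{*}\bar{\mathbf h}_{\mathrm r,k}^{\mathrm T}\bigr)\odot\boldsymbol\Sigma_{\mathrm r,k}, \] \[ \mathbf D_F=\tfrac{\beta_0\delta_0}{\delta_0+1}\bar{\mathbf H}^{\mathrm H}\boldsymbol\Lambda\bar{\mathbf H}+\tfrac{\beta_0}{\delta_0+1}\|\mathbf w\|_2^2\,\boldsymbol\Sigma_{\mathrm B}. \] For Hermitian matrices $\boldsymbol\Gamma_1,\dots,\boldsymbol\Gamma_K\in\mathbb C^{N\times N}$ put $\boldsymbol\Phi_k=\boldsymbol\Gamma_k/(2^{r_k}-1)-\sum_{i\ne k}\boldsymbol\Gamma_i$, and say that $(\boldsymbol\Gamma,\mathbf x,\mathbf y)$ with $\mathbf x,\mathbf y\in\mathbb R^K$ satisfies the outage constraints if for all $k$ \[ \begin{aligned} &\tfrac{\beta_k}{\delta_k+1}\mathrm{Tr}\{\boldsymbol\Lambda\}+\sqrt{2\ln(1/\rho_k)}\,x_k-\ln(\rho_k)\,y_k+\tfrac{\beta_k\delta_k}{\delta_k+1}\bar{\mathbf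 h}_{\mathrm r,k}^{\mathrm H}\boldsymbol\Lambda\bar{\mathbf h}_{\mathrm r,k}-\tfrac1{\sigma_z^2}\bigl(\tilde{\mathbf w}^{\mathrm H}\mathbf H_k\boldsymbol\Phi_k\mathbf H_k^{\mathrm H}\tilde{\mathbf w}-\sigma_k^2\bigr)\le0,\\ &\tfrac{\beta_k}{\delta_k+1}\|\mathbf C_k^{1/2}\mathbf p\|_2\le x_k,\qquad y_k\mathbf I-\mathbf U_k\succeq\mathbf 0,\qquad y_k\ge0 . \end{aligned} \] Consider the rank-relaxed problem \[ \text{(R)}\qquad \min_{\boldsymbol\Gamma,\mathbf x,\mathbf y}\ \mathrm{Tr}\Bigl\{(\mathbf I+\mathbf D_F)\sum_{k=1}^K\boldsymbol\Gamma_k\Bigr\}\quad\text{subject to the outage constraints and } \boldsymbol\Gamma_k\succeq\mathbf 0\ \text{for all } k, \] and the precoder problem \[ \text{(P)}\qquad \min_{\mathbf F,\mathbf x,\mathbf y}\ \|\mathbf F\|_F^2+\mathrm{Tr}\{\boldsymbol\Lambda\mathbf Q\}+\|\mathbf w\|_2^2\sigma_z^2\quad\text{subject to the outage constraints with }\boldsymbol\Gamma_k=\mathbf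 f_k\mathbf f_k^{\mathrm H}, \] where $\mathbf F=[\mathbf f_1,\dots,\mathbf f_K]\in\mathbb C^{N\times K}$ and $\mathbf Q=\frac{\beta_0\delta_0}{\delta_0+1}\bar{\mathbf H}\mathbf F\mathbf F^{\mathrm H}\bar{\mathbf H}^{\mathrm H}+\frac{\beta_0}{\delta_0+1}\mathrm{Tr}\{\mathbf F\mathbf F^{\mathrm H}\boldsymbol\Sigma_{\mathrm B}\}\boldsymbol\Sigma_{\mathrm R}$. If (R) is feasible, then (R) has an optimal solution $(\boldsymbol\Gamma^\star,\mathbf x^\star,\mathbf y^\star)$ with $\mathrm{rank}(\boldsymbol\Gamma_k^\star)=1$ for every $k$. Moreover, optimal beamformers are obtained from any such solution by eigenvalue decomposition: for every $k$ there are $\lambda_k>0$ and a unit vector $\mathbf v_k$ with $\boldsymbol\Gamma_k^\star\mathbf v_k=\lambda_k\mathbf v_k$, and for every such choice the vectors $\mathbf f_k=\sqrt{\lambda_k}\,\mathbf v_k$ satisfy $\boldsymbol\Gamma_k^\star=\mathbf f_k\mathbf f_k^{\mathrm H}$ for every $k$, and $(\mathbf F,\mathbf x^\star,\mathbf y^\star)$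 is an optimal solution of (P). -/

import Mathlib

open scoped Matrix MatrixOrder ComplexOrder

noncomputable section

/-- Statistical and instantaneous channel data of a downlink with an `N`-antenna base station (BS),
an active reconfigurable intelligent surface (RIS) with `M` elements, and `K` single-antenna
users, together with the quality-of-service targets of the users. -/
structure RISSystem (M N K : ℕ) where
  /-- path-loss coefficient of the BS-RIS channel -/
  β₀ : ℝ
  /-- Rician factor of the BS-RIS channel -/
  δ₀ : ℝ
  /-- path-loss coefficients of the RIS-user channels -/
  β : Fin K → ℝ
  /-- Rician factors of the RIS-user channels -/
  δ : Fin K → ℝ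
  /-- line-of-sight component of the BS-RIS channel -/
  Hbar : Matrix (Fin M) (Fin N) ℂ
  /-- line-of-sight components of the RIS-user channels -/
  hbar : Fin K → Fin M → ℂ
  /-- spatial correlation matrix at the BS (BS-RIS channel) -/
  SigB : Matrix (Fin N) (Fin N) ℂ
  /-- spatial correlation matrix at the RIS (BS-RIS channel) -/
  SigR : Matrix (Fin M) (Fin M) ℂ
  /-- spatial correlation matrices at the RIS (RIS-user channels) -/
  Sigr : Fin K → Matrix (Fin M) (Fin M) ℂ
  /-- direct channels between the BS and the users -/
  h : Fin K → Fin N → ℂ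
  /-- cascaded BS-RIS-user channels -/
  G : Fin K → Matrix (Fin M) (Fin N) ℂ
  /-- standard deviation of the thermal noise at the RIS; the noise power is its square -/
  σz : ℝ
  /-- standard deviations of the noise at the users; the noise powers are the squares -/
  σ : Fin K → ℝ
  /-- target rates -/
  r : Fin K → ℝ
  /-- maximum outage probabilities -/
  ρ : Fin K → ℝ
  β₀_nonneg : 0 ≤ β₀
  δ₀_nonneg : 0 ≤ δ₀
  β_nonneg : ∀ k, 0 ≤ β k
  δ_nonneg : ∀ k, 0 ≤ δ k
  SigB_posSemidef : SigB.PosSemidef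
  SigB_diag : ∀ n, SigB n n = 1
  SigR_posSemidef : SigR.PosSemidef
  SigR_diag : ∀ m, SigR m m = 1
  Sigr_posSemidef : ∀ k, (Sigr k).PosSemidef
  Sigr_diag : ∀ k m, Sigr k m m = 1
  σz_pos : 0 < σz
  σ_pos : ∀ k, 0 < σ k
  r_pos : ∀ k, 0 < r k
  ρ_pos : ∀ k, 0 < ρ k
  ρ_le_one : ∀ k, ρ k ≤ 1

namespace RISSystem

variable {M N K : ℕ} (S : RISSystem M N K)

/-- The reflection matrix `Λ_w = Diag(w)`. -/
def reflection (w : Fin M → ℂ) : Matrix (Fin M) (Fin M) ℂ := Matrix.diagonal w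

/-- `Λ_RIS = Λ_wᴴ Λ_w`. -/
def LamRIS (w : Fin M → ℂ) : Matrix (Fin M) (Fin M) ℂ := (reflection w)ᴴ * reflection w

/-- `p_RIS`, the vector of diagonal entries of `Λ_RIS`. -/
def pRIS (w : Fin M → ℂ) : Fin M → ℂ := (LamRIS w).diag

/-- The extended reflection vector, `w` followed by the entry `1`. -/
def wExt (w : Fin M → ℂ) : Fin M ⊕ Unit → ℂ := Sum.elim w (fun _ => 1)

/-- The stacked channel `H_k` with the rows of `G_k` followed by the row `h_kᴴ`. -/
def stacked (k : Fin K) : Matrix (Fin M ⊕ Unit) (Fin N) ℂ :=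
  Matrix.fromRows (S.G k) (Matrix.replicateRow Unit (star (S.h k)))

/-- `Φ_k = Γ_k / (2 ^ r_k - 1) - ∑_{i ≠ k} Γ_i`. -/
def Phi (Γ : Fin K → Matrix (Fin N) (Fin N) ℂ) (k : Fin K) : Matrix (Fin N) (Fin N) ℂ :=
  (((2 : ℝ) ^ S.r k - 1)⁻¹ : ℝ) • Γ k - ∑ i ∈ Finset.univ.erase k, Γ i

/-- The matrix `C_k = (Σ_{r,k}ᵀ + 2 δ_k h̄_k^* h̄_kᵀ) ⊙ Σ_{r,k}`. -/
def CMat (k : Fin K) : Matrix (Fin M) (Fin M) ℂ :=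
  ((S.Sigr k)ᵀ + (2 * S.δ k : ℝ) • Matrix.vecMulVec (star (S.hbar k)) (S.hbar k)) ⊙ S.Sigr k

/-- `U_k = β_k / (δ_k + 1) Σ_{r,k}^{1/2} Λ_RIS Σ_{r,k}^{1/2}`. -/
def UMat (w : Fin M → ℂ) (k : Fin K) : Matrix (Fin M) (Fin M) ℂ :=
  (S.β k / (S.δ k + 1) : ℝ) • (CFC.sqrt (S.Sigr k) * LamRIS w * CFC.sqrt (S.Sigr k))

/-- The deterministic (Bernstein-type) replacement of the outage constraint of user `k`. The
complex numbers whose real part is taken are real when the `Γ_i` are Hermitian. -/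
structure OutageConstraint (w : Fin M → ℂ) (Γ : Fin K → Matrix (Fin N) (Fin N) ℂ)
    (x y : Fin K → ℝ) (k : Fin K) : Prop where
  linear :
    S.β k / (S.δ k + 1) * (LamRIS w).trace.re
      + Real.sqrt (2 * Real.log (1 / S.ρ k)) * x k
      - Real.log (S.ρ k) * y k
      + S.β k * S.δ k / (S.δ k + 1) * (star (S.hbar k) ⬝ᵥ LamRIS w *ᵥ S.hbar k).re
      - 1 / S.σz ^ 2 *
        ((star (wExt w) ⬝ᵥ (S.stacked k * S.Phi Γ k * (S.stacked k)ᴴ) *ᵥ wExt w).re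
          - S.σ k ^ 2) ≤ 0
  norm_le :
    S.β k / (S.δ k + 1) * ‖WithLp.toLp 2 (CFC.sqrt (S.CMat k) *ᵥ pRIS w)‖ ≤ x k
  lmi : ((y k : ℂ) • (1 : Matrix (Fin M) (Fin M) ℂ) - S.UMat w k).PosSemidef
  y_nonneg : 0 ≤ y k

/-- `D_F = β₀ δ₀ / (δ₀ + 1) H̄ᴴ Λ_RIS H̄ + β₀ / (δ₀ + 1) ‖w‖² Σ_B`. -/
def DF (w : Fin M → ℂ) : Matrix (Fin N) (Fin N) ℂ :=
  (S.β₀ * S.δ₀ / (S.δ₀ + 1) : ℝ) • (S.Hbarᴴ * LamRIS w * S.Hbar)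
    + (S.β₀ / (S.δ₀ + 1) * ‖WithLp.toLp 2 w‖ ^ 2 : ℝ) • S.SigB

/-- Objective of the rank-relaxed problem, `Tr((I + D_F) ∑_k Γ_k)`. -/
def sdpObjective (w : Fin M → ℂ) (Γ : Fin K → Matrix (Fin N) (Fin N) ℂ) : ℝ :=
  ((1 + S.DF w) * ∑ k, Γ k).trace.re

/-- Feasibility of `(Γ, x, y)` for the rank-relaxed problem with given reflection vector `w`. -/
structure SDPFeasible (w : Fin M → ℂ) (Γ : Fin K → Matrix (Fin N) (Fin N) ℂ)
    (x y : Fin K → ℝ) : Prop where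
  outage : ∀ k, S.OutageConstraint w Γ x y k
  posSemidef : ∀ k, (Γ k).PosSemidef

/-- Global optimality of `(Γ, x, y)` for the rank-relaxed problem. -/
def SDPOptimal (w : Fin M → ℂ) (Γ : Fin K → Matrix (Fin N) (Fin N) ℂ) (x y : Fin K → ℝ) : Prop :=
  S.SDPFeasible w Γ x y ∧
    ∀ Γ' x' y', S.SDPFeasible w Γ' x' y' → S.sdpObjective w Γ ≤ S.sdpObjective w Γ'

/-- The covariance matrix `f fᴴ` of a beamformer `f`. -/
def outer (f : Fin N → ℂ) : Matrix (Fin N) (Fin N) ℂ := Matrix.vecMulVec f (star f)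

/-- `Q = β₀ δ₀ / (δ₀ + 1) H̄ F Fᴴ H̄ᴴ + β₀ / (δ₀ + 1) Tr(F Fᴴ Σ_B) Σ_R`. -/
def QMat (F : Matrix (Fin N) (Fin K) ℂ) : Matrix (Fin M) (Fin M) ℂ :=
  (S.β₀ * S.δ₀ / (S.δ₀ + 1) : ℝ) • (S.Hbar * (F * Fᴴ) * S.Hbarᴴ)
    + (S.β₀ / (S.δ₀ + 1) : ℝ) • ((F * Fᴴ * S.SigB).trace • S.SigR)

/-- The average transmit power of the RIS, `Tr(Λ_RIS Q) + ‖w‖² σ_z²`. -/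
def risPower (F : Matrix (Fin N) (Fin K) ℂ) (w : Fin M → ℂ) : ℝ :=
  (LamRIS w * S.QMat F).trace.re + ‖WithLp.toLp 2 w‖ ^ 2 * S.σz ^ 2

/-- Total power `‖F‖_F² + P(F, w)` with the precoder `F = [f_1, …, f_K]`. -/
def totalPower (F : Matrix (Fin N) (Fin K) ℂ) (w : Fin M → ℂ) : ℝ :=
  (∑ n, ∑ k, ‖F n k‖ ^ 2) + S.risPower F w

/-- Feasibility of `(F, x, y)` for the power minimization problem over the precoder, with given
reflection vector `w`; the `k`-th beamformer is the `k`-th column of `F`. -/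
def PrecoderFeasible (w : Fin M → ℂ) (F : Matrix (Fin N) (Fin K) ℂ) (x y : Fin K → ℝ) : Prop :=
  ∀ k, S.OutageConstraint w (fun i => outer (F.col i)) x y k

/-- Global optimality of `(F, x, y)` for the power minimization problem over the precoder. -/
def PrecoderOptimal (w : Fin M → ℂ) (F : Matrix (Fin N) (Fin K) ℂ) (x y : Fin K → ℝ) : Prop :=
  S.PrecoderFeasible w F x y ∧
    ∀ F' x' y', S.PrecoderFeasible w F' x' y' → S.totalPower F w ≤ S.totalPower F' w

/-- `f = √lam • v` for a positive eigenvalue `lam` of `A` and a unit eigenvector `v`. -/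
def IsEigenBeamformer (A : Matrix (Fin N) (Fin N) ℂ) (f : Fin N → ℂ) : Prop :=
  ∃ (lam : ℝ) (v : Fin N → ℂ), 0 < lam ∧ ‖WithLp.toLp 2 v‖ = 1 ∧ A *ᵥ v = (lam : ℂ) • v ∧
    f = (Real.sqrt lam : ℂ) • v

end RISSystem

end

/-! With `g` the effective channel of user `k`, the constraint of that user sees the covariances
only through the powers `gᴴ Γ_i g`. Replacing `Γ_k` by `Γ_k g gᴴ Γ_k / (gᴴ Γ_k g)` keeps the useful
power of user `k` and decreases `Γ_k` in the Loewner order. Interference at the other users and the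
objective therefore do not grow (`exists_outer_le`, `SDPFeasible.exists_outer`). The division is
legitimate because receiver noise forces `gᴴ Γ_k g > 0`.

So it suffices to minimise over rank-one covariances. The slacks can be frozen at least values
independent of `Γ` (`exists_least_slacks`); the objective is then continuous and coercive in the
beamformers on a closed set, so a minimum exists. By `totalPower_eq`, (P) is (R) restricted to outer
products, up to a constant in the objective, so rank-one optima of (R) solve (P). -/

/-! ### Positive semidefinite and rank-one matrices -/

theorem Matrix.PosSemidef.re_trace_mul_nonneg {n : Type*} [Fintype n] {A B : Matrix n n ℂ}
    (hA : A.PosSemidef) (hB : B.PosSemidef) : 0 ≤ (A * B).trace.re := by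
  classical
  obtain ⟨X, rfl⟩ := CStarAlgebra.nonneg_iff_eq_star_mul_self.mp
    (Matrix.nonneg_iff_posSemidef.mpr hB)
  rw [← Matrix.mul_assoc, Matrix.trace_mul_comm, ← Matrix.mul_assoc]
  exact (Complex.le_def.mp (hA.mul_mul_conjTranspose_same X).trace_nonneg).1

theorem Matrix.isClosed_setOf_posSemidef {n : Type*} [Fintype n] :
    IsClosed {A : Matrix n n ℂ | A.PosSemidef} := by
  simp only [Matrix.posSemidef_iff_dotProduct_mulVec, Set.ofPred_and, Set.ofPred_forall]
  refine IsClosed.inter ?_ (isClosed_iInter fun x => ?_)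
  · exact isClosed_eq (by fun_prop) continuous_id
  · exact isClosed_le continuous_const (by fun_prop)

/-- A positive semidefinite matrix dominates its compression along a vector. -/
theorem Matrix.PosSemidef.sub_vecMulVec {n : Type*} [Fintype n] {A : Matrix n n ℂ}
    (hA : A.PosSemidef) (g : n → ℂ) (hg : 0 < (star g ⬝ᵥ A *ᵥ g).re) :
    (A - ((star g ⬝ᵥ A *ᵥ g).re⁻¹ : ℂ) •
      Matrix.vecMulVec (A *ᵥ g) (star (A *ᵥ g))).PosSemidef := by
  classical
  set q : ℝ := (star g ⬝ᵥ A *ᵥ g).re with hq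
  have hqc : star g ⬝ᵥ A *ᵥ g = (q : ℂ) := by
    apply Complex.ext
    · simp [hq]
    · simpa using (Complex.le_def.mp (hA.dotProduct_mulVec_nonneg g)).2.symm
  have hq0 : (q : ℂ) ≠ 0 := by exact_mod_cast hg.ne'
  have hstar : star g ᵥ* A = star (A *ᵥ g) := by
    rw [Matrix.star_mulVec, hA.1.eq]
  have hstar' : star (A *ᵥ g) ⬝ᵥ g = (q : ℂ) := by
    rw [← hstar, ← Matrix.dotProduct_mulVec, hqc]
  -- The difference is `Bᴴ A B`, where `B` is the `A`-orthogonal projection that kills `g`.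
  have key := hA.conjTranspose_mul_mul_same
    (1 - (q⁻¹ : ℂ) • Matrix.vecMulVec g (star (A *ᵥ g)))
  convert key using 1
  have hc : ((q : ℂ)⁻¹ • Matrix.vecMulVec g (star (A *ᵥ g)))ᴴ
      = (q : ℂ)⁻¹ • Matrix.vecMulVec (A *ᵥ g) (star g) := by
    rw [Matrix.conjTranspose_smul, Matrix.conjTranspose_vecMulVec, star_star]
    congr 1
    simp
  rw [Matrix.conjTranspose_sub, hc, Matrix.conjTranspose_one]
  simp only [sub_mul, mul_sub, one_mul, mul_one, Matrix.smul_mul, Matrix.mul_smul,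
    Matrix.vecMulVec_mul, Matrix.mul_vecMulVec, hstar, Matrix.vecMulVec_mulVec, Matrix.smul_mulVec, hstar']
  ext i j
  simp [Matrix.vecMulVec_apply]
  field_simp
  ring

theorem Matrix.rank_vecMulVec_eq_one {m n : Type*} [Fintype n] [Fintype m] {a : m → ℂ} {b : n → ℂ}
    (ha : a ≠ 0) (hb : b ≠ 0) : (Matrix.vecMulVec a b).rank = 1 := by
  classical
  apply le_antisymm (Matrix.rank_vecMulVec_le a b)
  rw [Nat.one_le_iff_ne_zero, Ne, Matrix.rank, Submodule.finrank_eq_zero, LinearMap.range_eq_bot]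
  intro h
  obtain ⟨j, hj⟩ := Function.ne_iff.mp hb
  obtain ⟨i, hi⟩ := Function.ne_iff.mp ha
  have := congrFun (LinearMap.congr_fun h (Pi.single j 1)) i
  simp [Matrix.vecMulVec_apply] at this
  exact this.elim hi hj

/-- The range is the line through `v`, so `A` is `v` times some row `c`; Hermitian symmetry makes
`star v` a left eigenvector, which determines `c`. -/
theorem Matrix.eq_vecMulVec_of_rank_eq_one {n : Type*} [Fintype n]
    {A : Matrix n n ℂ} (hA : A.IsHermitian) (hr : A.rank = 1) {l : ℝ} (hl : l ≠ 0) {v : n → ℂ}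
    (hv : star v ⬝ᵥ v = 1) (h : A *ᵥ v = (l : ℂ) • v) :
    A = (l : ℂ) • Matrix.vecMulVec v (star v) := by
  classical
  have hv0 : v ≠ 0 := by rintro rfl; simp at hv
  have hlc : (l : ℂ) ≠ 0 := by exact_mod_cast hl
  have hmem : v ∈ LinearMap.range A.mulVecLin := by
    refine ⟨(l : ℂ)⁻¹ • v, ?_⟩
    rw [map_smul, Matrix.mulVecLin_apply, h, smul_smul, inv_mul_cancel₀ hlc, one_smul]
  have hspan := (finrank_eq_one_iff_of_nonzero' (⟨v, hmem⟩ : LinearMap.range A.mulVecLin)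
    (by simpa using hv0)).mp hr
  have hcol : ∀ j, ∃ c : ℂ, c • v = A *ᵥ Pi.single j 1 := fun j => by
    obtain ⟨c, hc⟩ := hspan ⟨A *ᵥ Pi.single j 1, ⟨_, rfl⟩⟩
    exact ⟨c, congrArg Subtype.val hc⟩
  choose c hc using hcol
  have hAc : A = Matrix.vecMulVec v c := by
    ext i j
    have := congrFun (hc j) i
    simp at this
    rw [Matrix.vecMulVec_apply, ← this, mul_comm]
  have hl' : star v ᵥ* A = (l : ℂ) • star v := by
    have := congrArg star h
    rwa [Matrix.star_mulVec, hA.eq, star_smul, Complex.star_def, Complex.conj_ofReal] at this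
  have hcv : c = (l : ℂ) • star v := by
    rw [← hl', hAc, Matrix.vecMul_vecMulVec, hv, one_smul]
  rw [hAc, hcv, Matrix.vecMulVec_smul]

theorem Matrix.PosSemidef.exists_pos_eigenvector {n : Type*} [Fintype n]
    {A : Matrix n n ℂ} (hA : A.PosSemidef) (h0 : A ≠ 0) :
    ∃ (l : ℝ) (v : n → ℂ), 0 < l ∧ ‖WithLp.toLp 2 v‖ = 1 ∧ A *ᵥ v = (l : ℂ) • v := by
  classical
  obtain ⟨i, hi⟩ : ∃ i, hA.1.eigenvalues i ≠ 0 := by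
    by_contra! hc
    exact h0 (hA.1.eigenvalues_eq_zero_iff.mp (funext hc))
  refine ⟨hA.1.eigenvalues i, ⇑(hA.1.eigenvectorBasis i),
    lt_of_le_of_ne (hA.eigenvalues_nonneg i) hi.symm, ?_, ?_⟩
  · exact hA.1.eigenvectorBasis.orthonormal.1 i
  · simpa using hA.1.mulVec_eigenvectorBasis i

/-! ### Monotonicity and coercivity of the objective -/

namespace RISSystem

variable {M N K : ℕ} (S : RISSystem M N K)

theorem LamRIS_posSemidef (w : Fin M → ℂ) : (LamRIS w).PosSemidef :=
  Matrix.posSemidef_conjTranspose_mul_self _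

theorem outer_posSemidef (f : Fin N → ℂ) : (outer f).PosSemidef :=
  Matrix.posSemidef_vecMulVec_self_star f

theorem DF_posSemidef (w : Fin M → ℂ) : (S.DF w).PosSemidef := by
  have h0 := S.β₀_nonneg
  have h1 := S.δ₀_nonneg
  exact (((LamRIS_posSemidef w).conjTranspose_mul_mul_same S.Hbar).smul (by positivity)).add
    (S.SigB_posSemidef.smul (by positivity))

theorem sdpObjective_sub (w : Fin M → ℂ) (Γ Γ' : Fin K → Matrix (Fin N) (Fin N) ℂ) :
    S.sdpObjective w Γ - S.sdpObjective w Γ'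
      = ((1 + S.DF w) * ∑ k, (Γ k - Γ' k)).trace.re := by
  simp only [sdpObjective, Finset.sum_sub_distrib, Matrix.mul_sub, Matrix.trace_sub,
    Complex.sub_re]

theorem sdpObjective_mono (w : Fin M → ℂ) {Γ Γ' : Fin K → Matrix (Fin N) (Fin N) ℂ}
    (h : ∀ k, (Γ k - Γ' k).PosSemidef) : S.sdpObjective w Γ' ≤ S.sdpObjective w Γ := by
  rw [← sub_nonneg, sdpObjective_sub]
  exact (Matrix.PosSemidef.one.add (S.DF_posSemidef w)).re_trace_mul_nonneg
    (Matrix.posSemidef_sum _ fun k _ => h k)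

theorem re_trace_sum_le_sdpObjective (w : Fin M → ℂ) {Γ : Fin K → Matrix (Fin N) (Fin N) ℂ}
    (h : ∀ k, (Γ k).PosSemidef) : (∑ k, Γ k).trace.re ≤ S.sdpObjective w Γ := by
  rw [sdpObjective, Matrix.add_mul, Matrix.one_mul, Matrix.trace_add, Complex.add_re]
  exact le_add_of_nonneg_right ((S.DF_posSemidef w).re_trace_mul_nonneg
    (Matrix.posSemidef_sum _ fun k _ => h k))

theorem re_trace_outer (f : Fin N → ℂ) : (outer f).trace.re = ∑ n, ‖f n‖ ^ 2 := by
  simp [outer, Matrix.trace_vecMulVec, dotProduct, Complex.mul_conj, Complex.sq_norm,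
    ← Complex.ofReal_sum]

/-- Coercivity: the identity part of `1 + D_F` contributes the sum of all squared entries, which
dominates the squared sup norm. -/
theorem norm_sq_le_sdpObjective_outer (w : Fin M → ℂ) (f : Fin K → Fin N → ℂ) :
    ‖f‖ ^ 2 ≤ S.sdpObjective w (fun k => outer (f k)) := by
  refine le_trans ?_ (S.re_trace_sum_le_sdpObjective w fun k => outer_posSemidef (f k))
  rw [Matrix.trace_sum, Complex.re_sum]
  simp only [re_trace_outer]
  have hnn : 0 ≤ ∑ k, ∑ n, ‖f k n‖ ^ 2 := by positivity
  refine (Real.le_sqrt (norm_nonneg _) hnn).mp ?_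
  refine (pi_norm_le_iff_of_nonneg (Real.sqrt_nonneg _)).mpr fun k =>
    (pi_norm_le_iff_of_nonneg (Real.sqrt_nonneg _)).mpr fun n => ?_
  refine Real.le_sqrt_of_sq_le ?_
  calc ‖f k n‖ ^ 2 ≤ ∑ n, ‖f k n‖ ^ 2 :=
        Finset.single_le_sum (f := fun n => ‖f k n‖ ^ 2) (fun _ _ => by positivity)
          (Finset.mem_univ n)
    _ ≤ _ := Finset.single_le_sum (f := fun k => ∑ n, ‖f k n‖ ^ 2)
          (fun _ _ => by positivity) (Finset.mem_univ k)

/-! ### Received powers and the outage constraint -/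

/-- The effective channel of user `k`. -/
def effChannel (w : Fin M → ℂ) (k : Fin K) : Fin N → ℂ := (S.stacked k)ᴴ *ᵥ wExt w

/-- The power received by user `k` from a signal with covariance `A`. -/
def recvPower (w : Fin M → ℂ) (k : Fin K) (A : Matrix (Fin N) (Fin N) ℂ) : ℝ :=
  (star (S.effChannel w k) ⬝ᵥ A *ᵥ S.effChannel w k).re

theorem recvPower_nonneg (w : Fin M → ℂ) (k : Fin K) {A : Matrix (Fin N) (Fin N) ℂ}
    (hA : A.PosSemidef) : 0 ≤ S.recvPower w k A :=
  hA.re_dotProduct_nonneg _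

theorem recvPower_sub (w : Fin M → ℂ) (k : Fin K) (A B : Matrix (Fin N) (Fin N) ℂ) :
    S.recvPower w k (A - B) = S.recvPower w k A - S.recvPower w k B := by
  simp [recvPower, Matrix.sub_mulVec, dotProduct_sub]

theorem recvPower_le (w : Fin M → ℂ) (k : Fin K) {A B : Matrix (Fin N) (Fin N) ℂ}
    (h : (A - B).PosSemidef) : S.recvPower w k B ≤ S.recvPower w k A := by
  rw [← sub_nonneg, ← recvPower_sub]
  exact S.recvPower_nonneg w k h

theorem recvPower_Phi (w : Fin M → ℂ) (k : Fin K) (Γ : Fin K → Matrix (Fin N) (Fin N) ℂ) :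
    S.recvPower w k (S.Phi Γ k) = ((2 : ℝ) ^ S.r k - 1)⁻¹ * S.recvPower w k (Γ k)
      - ∑ i ∈ Finset.univ.erase k, S.recvPower w k (Γ i) := by
  rw [Phi, recvPower_sub]
  simp only [recvPower, Matrix.smul_mulVec, dotProduct_smul, Complex.smul_re, smul_eq_mul,
    Matrix.sum_mulVec, dotProduct_sum, Complex.re_sum]

theorem re_stacked_eq_recvPower (w : Fin M → ℂ) (k : Fin K) (A : Matrix (Fin N) (Fin N) ℂ) :
    (star (wExt w) ⬝ᵥ (S.stacked k * A * (S.stacked k)ᴴ) *ᵥ wExt w).re = S.recvPower w k A := by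
  rw [recvPower, effChannel, Matrix.star_mulVec, Matrix.conjTranspose_conjTranspose,
    ← Matrix.mulVec_mulVec, ← Matrix.mulVec_mulVec, Matrix.dotProduct_mulVec]

theorem rate_gain_pos (k : Fin K) : 0 < ((2 : ℝ) ^ S.r k - 1)⁻¹ :=
  inv_pos.mpr (sub_pos.mpr (Real.one_lt_rpow one_lt_two (S.r_pos k)))

theorem neg_log_nonneg (k : Fin K) : 0 ≤ -Real.log (S.ρ k) :=
  neg_nonneg.mpr (Real.log_nonpos (S.ρ_pos k).le (S.ρ_le_one k))

variable {S}

/-- The outage constraint is preserved if the slacks shrink and the useful power grows. -/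
theorem OutageConstraint.mono {w : Fin M → ℂ} {Γ Γ' : Fin K → Matrix (Fin N) (Fin N) ℂ}
    {x y x' y' : Fin K → ℝ} {k : Fin K} (h : S.OutageConstraint w Γ x y k)
    (hΓ : S.recvPower w k (S.Phi Γ k) ≤ S.recvPower w k (S.Phi Γ' k))
    (hx : x' k ≤ x k) (hy : y' k ≤ y k)
    (hn : S.β k / (S.δ k + 1) * ‖WithLp.toLp 2 (CFC.sqrt (S.CMat k) *ᵥ pRIS w)‖ ≤ x' k)
    (hl : ((y' k : ℂ) • (1 : Matrix (Fin M) (Fin M) ℂ) - S.UMat w k).PosSemidef)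
    (hy0 : 0 ≤ y' k) : S.OutageConstraint w Γ' x' y' k := by
  refine ⟨?_, hn, hl, hy0⟩
  have h1 := h.linear
  rw [re_stacked_eq_recvPower] at h1 ⊢
  have h2 := mul_le_mul_of_nonneg_left hx (Real.sqrt_nonneg (2 * Real.log (1 / S.ρ k)))
  have h3 := mul_le_mul_of_nonneg_left hy (S.neg_log_nonneg k)
  have h4 := mul_le_mul_of_nonneg_left hΓ (show 0 ≤ 1 / S.σz ^ 2 by positivity)
  linarith

/-- The other terms of the linear constraint are nonnegative, so this power is at least `σ_k ^ 2`.
-/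
theorem OutageConstraint.recvPower_Phi_pos {w : Fin M → ℂ}
    {Γ : Fin K → Matrix (Fin N) (Fin N) ℂ} {x y : Fin K → ℝ} {k : Fin K}
    (h : S.OutageConstraint w Γ x y k) : 0 < S.recvPower w k (S.Phi Γ k) := by
  have h1 := h.linear
  rw [re_stacked_eq_recvPower] at h1
  have hβ := S.β_nonneg k
  have hδ := S.δ_nonneg k
  have hx : 0 ≤ x k := le_trans (by positivity) h.norm_le
  have a1 : 0 ≤ S.β k / (S.δ k + 1) * (LamRIS w).trace.re :=
    mul_nonneg (by positivity) (Complex.le_def.mp (LamRIS_posSemidef w).trace_nonneg).1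
  have a2 : 0 ≤ Real.sqrt (2 * Real.log (1 / S.ρ k)) * x k := by positivity
  have a3 : 0 ≤ -Real.log (S.ρ k) * y k := mul_nonneg (S.neg_log_nonneg k) h.y_nonneg
  have a4 : 0 ≤ S.β k * S.δ k / (S.δ k + 1) * (star (S.hbar k) ⬝ᵥ LamRIS w *ᵥ S.hbar k).re :=
    mul_nonneg (by positivity) ((LamRIS_posSemidef w).re_dotProduct_nonneg _)
  have hσ := S.σ_pos k
  have hz := S.σz_pos
  have h5 : 0 ≤ 1 / S.σz ^ 2 * (S.recvPower w k (S.Phi Γ k) - S.σ k ^ 2) := by linarith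
  have h6 := nonneg_of_mul_nonneg_right h5 (by positivity)
  have : 0 < S.σ k ^ 2 := by positivity
  linarith

theorem SDPFeasible.recvPower_pos {w : Fin M → ℂ}
    {Γ : Fin K → Matrix (Fin N) (Fin N) ℂ} {x y : Fin K → ℝ}
    (h : S.SDPFeasible w Γ x y) (k : Fin K) : 0 < S.recvPower w k (Γ k) := by
  have h1 := (h.outage k).recvPower_Phi_pos
  rw [recvPower_Phi] at h1
  have h2 : 0 ≤ ∑ i ∈ Finset.univ.erase k, S.recvPower w k (Γ i) :=
    Finset.sum_nonneg fun i _ => S.recvPower_nonneg w k (h.posSemidef i)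
  exact pos_of_mul_pos_right (by linarith) (S.rate_gain_pos k).le

/-! ### Reduction to rank one -/

theorem outer_real_smul (c : ℝ) (f : Fin N → ℂ) :
    outer ((c : ℂ) • f) = ((c ^ 2 : ℝ) : ℂ) • Matrix.vecMulVec f (star f) := by
  ext i j
  simp [outer, Matrix.vecMulVec_apply]
  ring

/-- Every feasible covariance dominates a rank-one covariance with the same useful power. -/
theorem exists_outer_le (S : RISSystem M N K) (w : Fin M → ℂ) (k : Fin K)
    {A : Matrix (Fin N) (Fin N) ℂ} (hA : A.PosSemidef) (h : 0 < S.recvPower w k A) :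
    ∃ f : Fin N → ℂ, (A - outer f).PosSemidef ∧
      S.recvPower w k (outer f) = S.recvPower w k A := by
  set g := S.effChannel w k with hg
  set q := S.recvPower w k A with hq
  have hqc : star g ⬝ᵥ A *ᵥ g = (q : ℂ) := by
    apply Complex.ext
    · rfl
    · simpa using (Complex.le_def.mp (hA.dotProduct_mulVec_nonneg g)).2.symm
  have hq0 : (q : ℂ) ≠ 0 := by exact_mod_cast h.ne'
  have hf : outer (((Real.sqrt q)⁻¹ : ℝ) • (A *ᵥ g) : Fin N → ℂ)
      = (q⁻¹ : ℂ) • Matrix.vecMulVec (A *ᵥ g) (star (A *ᵥ g)) := by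
    have := outer_real_smul (Real.sqrt q)⁻¹ (A *ᵥ g)
    rw [inv_pow, Real.sq_sqrt h.le, Complex.ofReal_inv q] at this
    rw [← this]
    rfl
  refine ⟨((Real.sqrt q)⁻¹ : ℝ) • (A *ᵥ g), ?_, ?_⟩
  · rw [hf]
    exact hA.sub_vecMulVec g h
  · have hstar : star (A *ᵥ g) ⬝ᵥ g = (q : ℂ) := by
      rw [Matrix.star_mulVec, hA.1.eq, ← Matrix.dotProduct_mulVec, hqc]
    rw [recvPower, hf, ← hg, Matrix.smul_mulVec, Matrix.vecMulVec_mulVec, hstar]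
    simp [hqc, hq0]

theorem SDPFeasible.exists_outer {w : Fin M → ℂ}
    {Γ : Fin K → Matrix (Fin N) (Fin N) ℂ} {x y : Fin K → ℝ}
    (h : S.SDPFeasible w Γ x y) :
    ∃ f : Fin K → Fin N → ℂ, S.SDPFeasible w (fun k => outer (f k)) x y ∧
      S.sdpObjective w (fun k => outer (f k)) ≤ S.sdpObjective w Γ := by
  choose f hf hfq using fun k => S.exists_outer_le w k (h.posSemidef k) (h.recvPower_pos k)
  refine ⟨f, ⟨fun k => ?_, fun k => outer_posSemidef _⟩, S.sdpObjective_mono w hf⟩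
  have hk := h.outage k
  refine hk.mono ?_ le_rfl le_rfl hk.norm_le hk.lmi hk.y_nonneg
  rw [recvPower_Phi, recvPower_Phi, hfq]
  exact sub_le_sub_left (Finset.sum_le_sum fun i _ => S.recvPower_le w k (hf i)) _

/-! ### Attainment of the minimum -/

/-- There are slacks that are feasible whenever any slacks are. -/
theorem exists_least_slacks {w : Fin M → ℂ} (hfeas : ∃ Γ x y, S.SDPFeasible w Γ x y) :
    ∃ x₀ y₀, ∀ Γ x y, S.SDPFeasible w Γ x y → S.SDPFeasible w Γ x₀ y₀ := by
  obtain ⟨Γ₁, x₁, y₁, h₁⟩ := hfeas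
  -- Admissible values of `y k` do not depend on `Γ`; they form a closed set bounded below, so the
  -- infimum is itself admissible.
  let Y : Fin K → Set ℝ := fun k =>
    {t | 0 ≤ t ∧ ((t : ℂ) • (1 : Matrix (Fin M) (Fin M) ℂ) - S.UMat w k).PosSemidef}
  have hYc : ∀ k, IsClosed (Y k) := fun k =>
    isClosed_Ici.inter (Matrix.isClosed_setOf_posSemidef.preimage
      (f := fun t : ℝ => (t : ℂ) • (1 : Matrix (Fin M) (Fin M) ℂ) - S.UMat w k) (by fun_prop))
  have hYb : ∀ k, BddBelow (Y k) := fun k => ⟨0, fun t ht => ht.1⟩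
  have hmem : ∀ k, sInf (Y k) ∈ Y k := fun k =>
    (hYc k).csInf_mem ⟨y₁ k, (h₁.outage k).y_nonneg, (h₁.outage k).lmi⟩ (hYb k)
  refine ⟨fun k => S.β k / (S.δ k + 1) * ‖WithLp.toLp 2 (CFC.sqrt (S.CMat k) *ᵥ pRIS w)‖,
    fun k => sInf (Y k), fun Γ x y h => ⟨fun k => ?_, h.posSemidef⟩⟩
  have hk := h.outage k
  exact hk.mono le_rfl hk.norm_le (csInf_le (hYb k) ⟨hk.y_nonneg, hk.lmi⟩) le_rfl
    (hmem k).2 (hmem k).1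

theorem continuous_outer : Continuous (outer : (Fin N → ℂ) → Matrix (Fin N) (Fin N) ℂ) := by
  unfold outer
  fun_prop

theorem isClosed_setOf_outer_feasible (S : RISSystem M N K) (w : Fin M → ℂ) (x y : Fin K → ℝ) :
    IsClosed {f : Fin K → Fin N → ℂ | S.SDPFeasible w (fun k => outer (f k)) x y} := by
  -- These conditions do not involve `f`: if one fails, the feasible set is empty.
  by_cases hc : ∀ k,
      S.β k / (S.δ k + 1) * ‖WithLp.toLp 2 (CFC.sqrt (S.CMat k) *ᵥ pRIS w)‖ ≤ x k ∧
      ((y k : ℂ) • (1 : Matrix (Fin M) (Fin M) ℂ) - S.UMat w k).PosSemidef ∧ 0 ≤ y k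
  · have : {f : Fin K → Fin N → ℂ | S.SDPFeasible w (fun k => outer (f k)) x y} =
        ⋂ k, {f | S.β k / (S.δ k + 1) * (LamRIS w).trace.re
          + Real.sqrt (2 * Real.log (1 / S.ρ k)) * x k
          - Real.log (S.ρ k) * y k
          + S.β k * S.δ k / (S.δ k + 1) * (star (S.hbar k) ⬝ᵥ LamRIS w *ᵥ S.hbar k).re
          - 1 / S.σz ^ 2 * ((star (wExt w) ⬝ᵥ (S.stacked k * S.Phi (fun k => outer (f k)) k *
            (S.stacked k)ᴴ) *ᵥ wExt w).re - S.σ k ^ 2) ≤ 0} := by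
      ext f
      simp only [Set.mem_iInter]
      exact ⟨fun h k => (h.outage k).linear,
        fun h => ⟨fun k => ⟨h k, (hc k).1, (hc k).2.1, (hc k).2.2⟩,
          fun k => outer_posSemidef _⟩⟩
    rw [this]
    refine isClosed_iInter fun k => isClosed_le ?_ continuous_const
    have hout : ∀ i, Continuous fun f : Fin K → Fin N → ℂ => outer (f i) := fun i =>
      continuous_outer.comp (continuous_apply i)
    have hPhi : Continuous fun f : Fin K → Fin N → ℂ => S.Phi (fun k => outer (f k)) k := by
      have hsum : Continuous fun f : Fin K → Fin N → ℂ =>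
          ∑ i ∈ Finset.univ.erase k, outer (f i) := continuous_finsetSum _ fun i _ => hout i
      unfold Phi
      fun_prop
    fun_prop
  · convert isClosed_empty
    ext f
    simp only [Set.mem_empty_iff_false, iff_false]
    exact fun h => hc fun k =>
      ⟨(h.outage k).norm_le, (h.outage k).lmi, (h.outage k).y_nonneg⟩

theorem continuous_sdpObjective_outer (S : RISSystem M N K) (w : Fin M → ℂ) :
    Continuous fun f : Fin K → Fin N → ℂ => S.sdpObjective w (fun k => outer (f k)) := by
  have hout : ∀ i, Continuous fun f : Fin K → Fin N → ℂ => outer (f i) := fun i =>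
    continuous_outer.comp (continuous_apply i)
  have hsum : Continuous fun f : Fin K → Fin N → ℂ => ∑ k, outer (f k) :=
    continuous_finsetSum _ fun i _ => hout i
  unfold sdpObjective
  fun_prop

theorem exists_optimal_outer {w : Fin M → ℂ} (hfeas : ∃ Γ x y, S.SDPFeasible w Γ x y) :
    ∃ (f : Fin K → Fin N → ℂ) (x y : Fin K → ℝ), S.SDPOptimal w (fun k => outer (f k)) x y := by
  obtain ⟨x₀, y₀, h₀⟩ := exists_least_slacks hfeas
  obtain ⟨Γ₁, x₁, y₁, h₁⟩ := hfeas
  obtain ⟨f₁, hf₁, -⟩ := (h₀ _ _ _ h₁).exists_outer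
  set P := S.sdpObjective w (fun k => outer (f₁ k)) with hP
  obtain ⟨f, hf, hmin⟩ := (S.continuous_sdpObjective_outer w).continuousOn.exists_isMinOn'
    (S.isClosed_setOf_outer_feasible w x₀ y₀) (x₀ := f₁) hf₁ (by
      refine Filter.Eventually.filter_mono inf_le_left ?_
      -- The bound `1` gives `‖f‖ ≤ ‖f‖ ^ 2`, and the bound `P` then keeps the objective above its
      -- value at `f₁`.
      filter_upwards [(tendsto_norm_cocompact_atTop (E := Fin K → Fin N → ℂ)).eventually_ge_atTop
        (max P 1)] with f hf
      have h1 : 1 ≤ ‖f‖ := le_trans (le_max_right _ _) hf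
      have h2 : P ≤ ‖f‖ := le_trans (le_max_left _ _) hf
      exact h2.trans ((le_self_pow₀ h1 two_ne_zero).trans
        (S.norm_sq_le_sdpObjective_outer w f)))
  refine ⟨f, x₀, y₀, hf, fun Γ' x' y' h' => ?_⟩
  obtain ⟨f', hf', hle⟩ := (h₀ _ _ _ h').exists_outer
  exact (hmin hf').trans hle

/-- A zero beamformer would deliver no useful power, contradicting `recvPower_pos`. -/
theorem SDPFeasible.rank_outer {w : Fin M → ℂ} {f : Fin K → Fin N → ℂ} {x y : Fin K → ℝ}
    (h : S.SDPFeasible w (fun k => outer (f k)) x y) (k : Fin K) : (outer (f k)).rank = 1 := by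
  have hf : f k ≠ 0 := by
    intro h0
    have := h.recvPower_pos k
    simp [h0, outer, recvPower] at this
  exact Matrix.rank_vecMulVec_eq_one hf (star_ne_zero.mpr hf)

/-! ### Return to the precoder problem -/

theorem sum_outer_col (F : Matrix (Fin N) (Fin K) ℂ) : ∑ k, outer (F.col k) = F * Fᴴ := by
  ext i j
  simp [outer, Matrix.sum_apply, Matrix.vecMulVec_apply, Matrix.mul_apply]

theorem trace_LamRIS_mul (w : Fin M → ℂ) {A : Matrix (Fin M) (Fin M) ℂ} (hA : ∀ m, A m m = 1) :
    (LamRIS w * A).trace = ((‖WithLp.toLp 2 w‖ ^ 2 : ℝ) : ℂ) := by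
  rw [EuclideanSpace.norm_sq_eq]
  simp [LamRIS, reflection, Matrix.trace, Matrix.diagonal_conjTranspose, hA,
    Complex.conj_mul']

/-- Cyclicity of the trace moves `Λ_RIS` into `D_F`, and the unit diagonal of `Σ_R` produces the
factor `‖w‖ ^ 2`. The remaining noise term does not depend on `F`. -/
theorem totalPower_eq (S : RISSystem M N K) (w : Fin M → ℂ) (F : Matrix (Fin N) (Fin K) ℂ) :
    S.totalPower F w = S.sdpObjective w (fun k => outer (F.col k))
      + ‖WithLp.toLp 2 w‖ ^ 2 * S.σz ^ 2 := by
  have h1 : ∑ n, ∑ k, ‖F n k‖ ^ 2 = (F * Fᴴ).trace.re := by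
    rw [← sum_outer_col, Matrix.trace_sum, Complex.re_sum, Finset.sum_comm]
    simp only [re_trace_outer, Matrix.col_apply]
  have h2 : (LamRIS w * (S.Hbar * (F * Fᴴ) * S.Hbarᴴ)).trace
      = (S.Hbarᴴ * LamRIS w * S.Hbar * (F * Fᴴ)).trace := by
    rw [← Matrix.mul_assoc, Matrix.trace_mul_comm]
    simp only [Matrix.mul_assoc]
  rw [totalPower, risPower, sdpObjective, sum_outer_col, h1, DF, QMat]
  simp only [Matrix.add_mul, Matrix.mul_add, Matrix.one_mul, Matrix.smul_mul, Matrix.mul_smul,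
    Matrix.trace_add, Matrix.trace_smul, h2, trace_LamRIS_mul w S.SigR_diag,
    Matrix.trace_mul_comm (F * Fᴴ) S.SigB, Complex.add_re, Complex.smul_re, smul_eq_mul,
    Complex.re_mul_ofReal]
  ring

theorem IsEigenBeamformer.eq_outer {A : Matrix (Fin N) (Fin N) ℂ} {f : Fin N → ℂ}
    (h : IsEigenBeamformer A f) (hA : A.IsHermitian) (hr : A.rank = 1) : A = outer f := by
  obtain ⟨l, v, hl, hv, hAv, rfl⟩ := h
  have hv1 : star v ⬝ᵥ v = 1 := by
    rw [dotProduct_comm, ← EuclideanSpace.inner_toLp_toLp, inner_self_eq_norm_sq_to_K, hv]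
    simp
  rw [outer_real_smul, Real.sq_sqrt hl.le]
  exact Matrix.eq_vecMulVec_of_rank_eq_one hA hr hl.ne' hv1 hAv

end RISSystem

theorem theorem2 {M N K : ℕ} (S : RISSystem M N K) (w : Fin M → ℂ)
    (hfeas : ∃ Γ x y, S.SDPFeasible w Γ x y) :
    (∃ Γ x y, S.SDPOptimal w Γ x y ∧ ∀ k, (Γ k).rank = 1) ∧
    (∀ Γ x y, S.SDPOptimal w Γ x y → (∀ k, (Γ k).rank = 1) →
      (∃ F : Matrix (Fin N) (Fin K) ℂ, ∀ k, RISSystem.IsEigenBeamformer (Γ k) (F.col k)) ∧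
      ∀ F : Matrix (Fin N) (Fin K) ℂ, (∀ k, RISSystem.IsEigenBeamformer (Γ k) (F.col k)) →
        (∀ k, Γ k = RISSystem.outer (F.col k)) ∧ S.PrecoderOptimal w F x y) := by
  refine ⟨?_, fun Γ x y hopt hrank => ⟨?_, fun F hF => ?_⟩⟩
  · obtain ⟨f, x, y, h⟩ := RISSystem.exists_optimal_outer hfeas
    exact ⟨_, x, y, h, h.1.rank_outer⟩
  · have hex : ∀ k, ∃ f, RISSystem.IsEigenBeamformer (Γ k) f := fun k => by
      have h0 : Γ k ≠ 0 := fun h => by simpa [h] using hrank k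
      obtain ⟨l, v, hl, hv, hlv⟩ := (hopt.1.posSemidef k).exists_pos_eigenvector h0
      exact ⟨_, l, v, hl, hv, hlv, rfl⟩
    choose f hf using hex
    exact ⟨(Matrix.of f)ᵀ, hf⟩
  · have hΓ : ∀ k, Γ k = RISSystem.outer (F.col k) := fun k =>
      (hF k).eq_outer (hopt.1.posSemidef k).1 (hrank k)
    obtain rfl : Γ = fun k => RISSystem.outer (F.col k) := funext hΓ
    refine ⟨hΓ, hopt.1.outage, fun F' x' y' h' => ?_⟩
    rw [S.totalPower_eq, S.totalPower_eq]
    exact add_le_add_left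
      (hopt.2 _ x' y' ⟨h', fun k => RISSystem.outer_posSemidef _⟩) _
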